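/- **Conventions.** All graphs are finite and simple, $K$ is a field. For a graph $G$ on a vertex set $V$ let $S_G=K[x_v,y_v : v\in V]$, and let $J_G\subset S_G$ be the binomial edge ideal, generated by the binomials $x_uy_v-x_vy_u$ with $\{u,v\}\in E(G)$. For $T\subseteq V$ let $P_T(G)\subset S_G$ be the ideal generated by $\{x_i,y_i : i\in T\}$ and by the ideals $J_{\widetilde G_1},\dots,J_{\widetilde G_{c}}$, where $G_1,\dots,G_c$ are the connected components of the induced subgraph of $G$ on $V\setminus T$ and $\widetilde G_j$ is the complete graph on the vertex set of $G_j$. A vertex is a cut point of a graph if its deletion gives a graph with more connected components. $T\subseteq V$ has the cut point property for $G$ if each $i\in T$ is a cut point of the subgraph of $G$ induced on $(V\setminus T)\cup\{i\}$. Put $\mathcal C(G)=\{\emptyset\}\cup\{T\subseteq V : T \text{ has the cut point property for } G\}$ and $\overline{\mathcal C}(G)=\mathcal C(G)\setminus\{\emptyset\}$. The join $G*H$ of graphs on disjoint vertex sets is the disjoint union of $G$ and $H$ together with all edges between a vertex of $G$ and a vertex of $H$. For collections of sets, $\mathcal A\circ\mathcal B=\{A\cup B : A\in\mathcal A,\ B\in\mathcal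 B\}$ and $\bigcirc_{i=1}^r\mathcal A_i=\{\bigcup_{i=1}^r A_i : A_i\in\mathcal A_i \text{ for all } i\}$. Height is the height of an ideal, and $\dim$ is Krull dimension. **Proposition 4.4.** Let $r\ge 2$ and let $G_1,H_1,\dots,H_r$ be connected (in particular nonempty) graphs on pairwise disjoint vertex sets $[t],[n_1],\dots,[n_r]$ with $t,n_1,\dots,n_r$ elements, respectively. Let $G_2=\bigsqcup_{i=1}^r H_i$ be the disjoint union of the $H_i$, and let $n=t+\sum_{i=1}^r n_i$. Then: (a) $\displaystyle \mathcal C(G_1*G_2)=\{\emptyset\}\cup\Big(\big(\bigcirc_{i=1}^r\mathcal C(H_i)\big)\circ\{[t]\}\Big)\cup\Big(\overline{\mathcal C}(G_1)\circ\big\{\textstyle\bigcup_{i=1}^r[n_i]\big\}\Big).$ (b) $\displaystyle \operatorname{height} J_{G_1*G_2}=\min\Big\{2t+\sum_{i=1}^r\operatorname{height}J_{H_i},\ 2(n-t)+\operatorname{height}P_T(G_1),\ n-1 \ :\ T\in\overline{\mathcal C}(G_1)\Big\}.$ (c) $\displaystyle \dim S/J_{G_1*G_2}=\max\Big\{\sum_{i=1}^r\dim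 S_{H_i}/J_{H_i},\ \dim S_{G_1}/P_T(G_1),\ n+1 \ :\ T\in\overline{\mathcal C}(G_1)\Big\},$ where $S=S_{G_1*G_2}$. -/

import Mathlib

namespace BinomialEdge

section Graphs

/-- The join `G * H`: the disjoint union of `G` and `H` together with all edges between the two
vertex sets. -/
def graphJoin {V W : Type*} (G : SimpleGraph V) (H : SimpleGraph W) : SimpleGraph (V ⊕ W) :=
  (G ⊕g H) ⊔ completeBipartiteGraph V W

/-- The disjoint union of a family of graphs on pairwise disjoint vertex sets. -/
def disjointUnion {ι : Type*} {W : ι → Type*} (H : ∀ i, SimpleGraph (W i)) :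
    SimpleGraph (Σ i, W i) where
  Adj a b := ∃ (i : ι) (u v : W i), a = ⟨i, u⟩ ∧ b = ⟨i, v⟩ ∧ (H i).Adj u v
  symm := ⟨fun _ _ ⟨i, u, v, ha, hb, h⟩ => ⟨i, v, u, hb, ha, h.symm⟩⟩
  loopless := ⟨by
    rintro _ ⟨i, u, v, rfl, hb, h⟩
    have : u = v := by simpa using hb
    exact h.ne this⟩

/-- The number of connected components of a (finite) graph. -/
noncomputable def numComponents {V : Type*} (G : SimpleGraph V) : ℕ :=
  Nat.card G.ConnectedComponent

/-- `v` is a cut point of the (finite) graph `G`: deleting `v` gives a graph with more connected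
components than `G`. -/
def IsCutPoint {V : Type*} (G : SimpleGraph V) (v : V) : Prop :=
  numComponents G < numComponents (G.induce ({v}ᶜ : Set V))

/-- `T` has the cut point property for `G`: each `i ∈ T` is a cut point of the subgraph of `G`
induced on `([n] ∖ T) ∪ {i}`. -/
def HasCutPointProperty {V : Type*} (G : SimpleGraph V) (T : Set V) : Prop :=
  ∀ i ∈ T, IsCutPoint (G.induce (insert i Tᶜ)) ⟨i, Set.mem_insert i Tᶜ⟩

/-- The collection `𝒞(G)`. -/
def cutSets {V : Type*} (G : SimpleGraph V) : Set (Set V) :=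
  {∅} ∪ {T | HasCutPointProperty G T}

/-- The collection of nonempty members of `𝒞(G)`. -/
def nonemptyCutSets {V : Type*} (G : SimpleGraph V) : Set (Set V) :=
  cutSets G \ {∅}

/-- The join of two collections of subsets: all `A ∪ B` with `A ∈ 𝒜`, `B ∈ ℬ`. -/
def collJoin {α : Type*} (𝒜 ℬ : Set (Set α)) : Set (Set α) :=
  {C | ∃ A ∈ 𝒜, ∃ B ∈ ℬ, C = A ∪ B}

/-- The join of a family of collections of subsets: all `⋃ i, A i` with `A i ∈ 𝒜 i` for all `i`. -/
def collJoinFamily {ι α : Type*} (𝒜 : ι → Set (Set α)) : Set (Set α) :=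
  {C | ∃ A : ι → Set α, (∀ i, A i ∈ 𝒜 i) ∧ C = ⋃ i, A i}

end Graphs

section Ideals

variable (K : Type*) [Field K]

/-- The polynomial ring `K[x_v, y_v : v ∈ V]`; `x_v` is the variable `Sum.inl v` and `y_v` is the
variable `Sum.inr v`. -/
abbrev PolyRing (V : Type*) : Type _ := MvPolynomial (V ⊕ V) K

/-- The variable `x_v`. -/
noncomputable def xVar {V : Type*} (v : V) : PolyRing K V := MvPolynomial.X (Sum.inl v)

/-- The variable `y_v`. -/
noncomputable def yVar {V : Type*} (v : V) : PolyRing K V := MvPolynomial.X (Sum.inr v)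

/-- The binomial edge ideal `J_G`, generated by `x_u y_v - x_v y_u` for the edges `{u, v}` of `G`.
Both orders of the two ends are listed; they give the same generator up to sign. -/
noncomputable def binomialEdgeIdeal {V : Type*} (G : SimpleGraph V) : Ideal (PolyRing K V) :=
  Ideal.span {f | ∃ u v : V, G.Adj u v ∧ f = xVar K u * yVar K v - xVar K v * yVar K u}

/-- The ideal `P_T(G)`, generated by `x_i, y_i` for `i ∈ T` and by the binomial edge ideals of the
complete graphs on the vertex sets of the connected components of `G` induced on `V ∖ T`. -/
noncomputable def primeOf {V : Type*} (G : SimpleGraph V) (T : Set V) : Ideal (PolyRing K V) :=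
  Ideal.span {f | ∃ i ∈ T, f = xVar K i ∨ f = yVar K i} ⊔
    ⨆ C : (G.induce Tᶜ).ConnectedComponent,
      binomialEdgeIdeal K (⊤ : SimpleGraph (Subtype.val '' C.supp : Set V)).spanningCoe

end Ideals

end BinomialEdge

/-! For a prime `p` containing `J_G`, let `T` be the set of vertices with both variables in `p`.
Outside `T` the vectors `(x_v, y_v)` are nonzero modulo `p`, so proportionality along edges
propagates along paths and `p` contains `P_T(G)` (`exists_primeOf_le`). Hence height and dimension
of `J_G` come from those of the `P_T(G)`.

The primality of `P_T(G)` is not needed. The kernel of `x_v ↦ s_v a_l`, `y_v ↦ s_v b_l`, with `l`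
the component of `v`, is visibly prime, and the primes above it are those above `P_T(G)`
(`primeOf_le_iff_paramPrime_le`). Explicit chains of such kernels bound its height and coheight
below; the bounds add up to `2|V|`, the dimension of the polynomial ring, so both are sharp. With
`c(T)` the number of components left, `P_T(G)` has height `|T| + |V| - c(T)` and coheight `|V| - |T|
+ c(T)`. Thus one minimizer of `|T| - c(T)` gives both the height and the dimension of `J_G`, and it
has the cut point property.

In a join, a deletion that spares a vertex on each side leaves a connected graph, so a nonempty cut
set contains one side entirely and is governed by the other. This gives (a). The minimizer for the
join therefore has one of three shapes, which yield the three kinds of terms in (b) and (c). -/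

namespace BinomialEdge

/-! ### Kernels of monomial parametrizations: chains, height and coheight -/

section ParametrizedPrimes

open MvPolynomial
open scoped Classical

variable (K : Type*) [Field K] {V : Type*}

/-- The substitution `x_v ↦ s_v a_{c v}`, `y_v ↦ s_v b_{c v}`, where `s_v` is set to zero for
`v ∈ T` and `a_l` is set to zero for `l ∈ Z`. -/
noncomputable def paramMap (T Z : Set V) (c : V → V) :
    PolyRing K V →ₐ[K] MvPolynomial (V ⊕ V ⊕ V) K :=
  aeval (Sum.elim
    (fun v => if v ∈ T ∨ c v ∈ Z then 0 else X (Sum.inl v) * X (Sum.inr (Sum.inl (c v))))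
    (fun v => if v ∈ T then 0 else X (Sum.inl v) * X (Sum.inr (Sum.inr (c v)))))

@[simp] lemma paramMap_xVar (T Z : Set V) (c : V → V) (v : V) :
    paramMap K T Z c (xVar K v) =
      if v ∈ T ∨ c v ∈ Z then 0 else X (Sum.inl v) * X (Sum.inr (Sum.inl (c v))) := by
  simp [paramMap, xVar]

@[simp] lemma paramMap_yVar (T Z : Set V) (c : V → V) (v : V) :
    paramMap K T Z c (yVar K v) =
      if v ∈ T then 0 else X (Sum.inl v) * X (Sum.inr (Sum.inr (c v))) := by
  simp [paramMap, yVar]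

/-- The kernel of `paramMap`, a point of the spectrum. -/
noncomputable def paramPrime (T Z : Set V) (c : V → V) : PrimeSpectrum (PolyRing K V) :=
  ⟨RingHom.ker (paramMap K T Z c), RingHom.ker_isPrime _⟩

lemma mem_paramPrime {T Z : Set V} {c : V → V} {f : PolyRing K V} :
    f ∈ (paramPrime K T Z c).asIdeal ↔ paramMap K T Z c f = 0 := Iff.rfl

/-- A label is visible only through the vertices outside `T` that carry it. -/
lemma paramPrime_congr {T Z Z' : Set V} {c : V → V} (h : ∀ v ∉ T, (c v ∈ Z ↔ c v ∈ Z')) :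
    paramPrime K T Z c = paramPrime K T Z' c := by
  have : paramMap K T Z c = paramMap K T Z' c := by
    refine MvPolynomial.algHom_ext fun i => ?_
    rcases i with v | v
    · change paramMap K T Z c (xVar K v) = paramMap K T Z' c (xVar K v)
      by_cases hv : v ∈ T
      · simp [hv]
      · simp [hv, h v hv]
    · change paramMap K T Z c (yVar K v) = paramMap K T Z' c (yVar K v)
      simp
  simp [paramPrime, this]

/-- If one parametrization factors through another, its kernel is the larger one. All inclusions
between these primes are obtained by exhibiting such a `ψ`. -/
lemma paramPrime_le_of_comp {T Z T' Z' : Set V} {c c' : V → V}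
    (ψ : MvPolynomial (V ⊕ V ⊕ V) K →ₐ[K] MvPolynomial (V ⊕ V ⊕ V) K)
    (hx : ∀ v, ψ (paramMap K T Z c (xVar K v)) = paramMap K T' Z' c' (xVar K v))
    (hy : ∀ v, ψ (paramMap K T Z c (yVar K v)) = paramMap K T' Z' c' (yVar K v)) :
    paramPrime K T Z c ≤ paramPrime K T' Z' c' := by
  have h : ψ.comp (paramMap K T Z c) = paramMap K T' Z' c' := by
    refine MvPolynomial.algHom_ext fun i => ?_
    rcases i with v | v
    · exact hx v
    · exact hy v
  intro f hf
  have hf : paramMap K T Z c f = 0 := hf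
  change paramMap K T' Z' c' f = 0
  rw [← h, AlgHom.comp_apply, hf, map_zero]

lemma paramPrime_mono {T Z T' Z' : Set V} (c : V → V) (hT : T ⊆ T') (hZ : Z ⊆ Z') :
    paramPrime K T Z c ≤ paramPrime K T' Z' c := by
  refine paramPrime_le_of_comp K (aeval (Sum.elim (fun v => if v ∈ T' then 0 else X (Sum.inl v))
    (Sum.elim (fun a => if a ∈ Z' then 0 else X (Sum.inr (Sum.inl a)))
      fun b => X (Sum.inr (Sum.inr b))))) (fun v => ?_) (fun v => ?_)
  · have h1 := @hT v
    have h2 := @hZ (c v)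
    by_cases a : v ∈ T <;> by_cases b : c v ∈ Z <;> by_cases a' : v ∈ T' <;>
      by_cases b' : c v ∈ Z' <;> simp_all
  · have h1 := @hT v
    by_cases a : v ∈ T <;> by_cases a' : v ∈ T' <;> simp_all

lemma paramPrime_le_merge (T : Set V) (c g : V → V) :
    paramPrime K T ∅ c ≤ paramPrime K T ∅ (g ∘ c) := by
  refine paramPrime_le_of_comp K (aeval (Sum.elim (fun v => X (Sum.inl v))
    (Sum.elim (fun a => X (Sum.inr (Sum.inl (g a))))
      fun b => X (Sum.inr (Sum.inr (g b)))))) (fun v => ?_) (fun v => ?_)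
  · by_cases a : v ∈ T <;> simp [a]
  · by_cases a : v ∈ T <;> simp [a]

lemma paramPrime_lt_of_mem {p q : PrimeSpectrum (PolyRing K V)} (hle : p ≤ q)
    (f : PolyRing K V) (hq : f ∈ q.asIdeal) (hp : f ∉ p.asIdeal) : p < q :=
  lt_of_le_not_ge hle fun h => hp (h hq)

lemma paramPrime_lt_insert_label {T Z : Set V} {c : V → V} {v : V} (hv : v ∉ T) (hc : c v ∉ Z) :
    paramPrime K T Z c < paramPrime K T (insert (c v) Z) c := by
  refine paramPrime_lt_of_mem K (paramPrime_mono K c subset_rfl (Set.subset_insert _ _))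
    (xVar K v) ?_ ?_
  · simp [mem_paramPrime]
  · simp [mem_paramPrime, hv, hc]

lemma paramPrime_lt_insert_vertex {T Z : Set V} {c : V → V} {v : V} (hv : v ∉ T) :
    paramPrime K T Z c < paramPrime K (insert v T) Z c := by
  refine paramPrime_lt_of_mem K (paramPrime_mono K c (Set.subset_insert _ _) subset_rfl)
    (yVar K v) ?_ ?_
  · simp [mem_paramPrime]
  · simp [mem_paramPrime, hv]

lemma minor_mem_paramPrime {T : Set V} {c : V → V} {u v : V} (h : c u = c v) :
    xVar K u * yVar K v - xVar K v * yVar K u ∈ (paramPrime K T ∅ c).asIdeal := by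
  rw [mem_paramPrime]
  by_cases hu : u ∈ T <;> by_cases hv : v ∈ T <;> simp [hu, hv, h]
  ring

lemma minor_notMem_paramPrime {T : Set V} {c : V → V} {u v : V} (hu : u ∉ T) (hv : v ∉ T)
    (h : c u ≠ c v) :
    xVar K u * yVar K v - xVar K v * yVar K u ∉ (paramPrime K T ∅ c).asIdeal := by
  rw [mem_paramPrime]
  intro h0
  -- Specialize every `s` to 1, `a` to the indicator of `c u` and `b` to the indicator of `c v`; the
  -- minor becomes 1.
  have := congrArg (aeval (R := K) (S₁ := K) (Sum.elim (fun _ => (1 : K))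
    (Sum.elim (fun a => if a = c u then (1 : K) else 0) fun b => if b = c v then (1 : K) else 0)))
    h0
  simp [hu, hv, h, Ne.symm h] at this

lemma paramPrime_lt_merge {T : Set V} {c g : V → V} {u v : V} (hu : u ∉ T) (hv : v ∉ T)
    (h : c u ≠ c v) (hg : g (c u) = g (c v)) :
    paramPrime K T ∅ c < paramPrime K T ∅ (g ∘ c) :=
  paramPrime_lt_of_mem K (paramPrime_le_merge K T c g) _ (minor_mem_paramPrime K hg)
    (minor_notMem_paramPrime K hu hv h)

/-- Each vertex contributes two strict steps: killing its label `a_v` puts `x_v` in the kernel, then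
killing `s_v` adds `y_v`. The set `Z` exists to provide this intermediate prime. -/
lemma two_mul_card_le_height_paramPrime (T : Finset V) :
    ((2 * T.card : ℕ) : ℕ∞) ≤ Order.height (paramPrime K (T : Set V) (T : Set V) id) := by
  induction T using Finset.induction_on with
  | empty => simp
  | insert v T hv ih =>
    have h1 : paramPrime K (T : Set V) (T : Set V) id < paramPrime K T (insert v (T : Set V)) id :=
      paramPrime_lt_insert_label K (c := id) (by simpa using hv) (by simpa using hv)
    have h2 : paramPrime K (T : Set V) (insert v (T : Set V)) id <
        paramPrime K (insert v (T : Set V)) (insert v (T : Set V)) id :=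
      paramPrime_lt_insert_vertex K (by simpa using hv)
    have h3 := Order.height_add_one_le h1
    have h4 := Order.height_add_one_le h2
    rw [Finset.coe_insert]
    refine le_trans ?_ h4
    refine le_trans ?_ (add_le_add_left h3 1)
    rw [Finset.card_insert_of_notMem hv]
    calc ((2 * (T.card + 1) : ℕ) : ℕ∞) = ((2 * T.card : ℕ) : ℕ∞) + 1 + 1 := by
          push_cast; ring
      _ ≤ _ := by gcongr

/-- Once `T` is killed and all labels are distinct, the vertices of `M` are merged with their
representatives one by one. Each merge is strict because it adds the minor of `v` and `c v`. -/
lemma card_add_card_le_height_paramPrime (T M : Finset V) (c : V → V) (hcc : ∀ v, c (c v) = c v)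
    (hcT : ∀ v, c v ∈ T ↔ v ∈ T) (hT : ∀ v ∈ T, c v = v) (hM : ∀ v ∈ M, c v ≠ v) :
    ((2 * T.card + M.card : ℕ) : ℕ∞) ≤
      Order.height (paramPrime K (T : Set V) ∅ (fun v => if v ∈ M then c v else v)) := by
  induction M using Finset.induction_on with
  | empty =>
    simp only [Finset.card_empty, add_zero, Finset.notMem_empty, if_false]
    refine (two_mul_card_le_height_paramPrime K T).trans_eq ?_
    rw [paramPrime_congr K (c := id) (Z' := ∅) (fun v hv => by simpa using hv)]
    rfl
  | insert v M hv ih =>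
    have ih := ih fun w hw => hM w (Finset.mem_insert_of_mem hw)
    have hvT : v ∉ T := fun h => hM v (Finset.mem_insert_self v M) (hT v h)
    -- A representative is never moved, so it still carries its own label when `v` joins it.
    have hcv : c v ∉ M := fun h => hM (c v) (Finset.mem_insert_of_mem h) (hcc v)
    have hne : c v ≠ v := hM v (Finset.mem_insert_self v M)
    have hlt := paramPrime_lt_merge K (T := (T : Set V)) (u := v) (v := c v)
      (c := fun w => if w ∈ M then c w else w) (g := fun w => if w = v then c v else w)
      (by simpa using hvT) (by simpa [hcT] using hvT) (by simpa [hv, hcv] using hne.symm)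
      (by simp [hv, hcv])
    have heq : ((fun w => if w = v then c v else w) ∘ fun w => if w ∈ M then c w else w) =
        fun w => if w ∈ insert v M then c w else w := by
      funext w
      by_cases hw : w ∈ M
      · have : c w ≠ v := by
          rintro rfl
          exact hne (hcc w)
        simp [hw, this]
      · by_cases hwv : w = v
        · simp [hwv, hv]
        · simp [hw, hwv]
    rw [heq] at hlt
    refine le_trans ?_ (Order.height_add_one_le hlt)
    rw [Finset.card_insert_of_notMem hv]
    calc ((2 * T.card + (M.card + 1) : ℕ) : ℕ∞) = ((2 * T.card + M.card : ℕ) : ℕ∞) + 1 := by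
          push_cast; ring
      _ ≤ _ := by gcongr

lemma two_mul_card_le_coheight_paramPrime (R : Finset V) (c : V → V) (hc : ∀ v ∈ R, c v = v) :
    ((2 * R.card : ℕ) : ℕ∞) ≤
      Order.coheight (paramPrime K (R : Set V)ᶜ (R : Set V)ᶜ c) := by
  induction R using Finset.induction_on with
  | empty => simp
  | insert v R hv ih =>
    have ih := ih fun w hw => hc w (Finset.mem_insert_of_mem hw)
    have hcv := hc v (Finset.mem_insert_self v R)
    have hR : insert v ((insert v R : Finset V) : Set V)ᶜ = (R : Set V)ᶜ := by
      ext w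
      by_cases hw : w = v
      · simp [hw, hv]
      · simp [hw]
    have h1 := paramPrime_lt_insert_label K (c := c) (v := v)
      (T := ((insert v R : Finset V) : Set V)ᶜ) (Z := ((insert v R : Finset V) : Set V)ᶜ)
      (by simp) (by simp [hcv])
    have h2 := paramPrime_lt_insert_vertex K (c := c) (v := v)
      (T := ((insert v R : Finset V) : Set V)ᶜ) (Z := (R : Set V)ᶜ) (by simp)
    rw [hcv, hR] at h1
    rw [hR] at h2
    refine le_trans ?_ (Order.coheight_add_one_le h1)
    refine le_trans ?_ (add_le_add_left (Order.coheight_add_one_le h2) 1)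
    rw [Finset.card_insert_of_notMem hv]
    calc ((2 * (R.card + 1) : ℕ) : ℕ∞) = ((2 * R.card : ℕ) : ℕ∞) + 1 + 1 := by
          push_cast; ring
      _ ≤ _ := by gcongr

/-- Killing `s_v` adds `y_v` to the kernel, one strict step for each vertex of `M`. -/
lemma coheight_paramPrime_union (T Z : Set V) (M : Finset V) (c : V → V) (hM : ∀ v ∈ M, v ∉ T) :
    Order.coheight (paramPrime K (T ∪ M) Z c) + M.card ≤ Order.coheight (paramPrime K T Z c) := by
  induction M using Finset.induction_on with
  | empty => simp
  | insert v M hv ih =>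
    have ih := ih fun w hw => hM w (Finset.mem_insert_of_mem hw)
    have hvT := hM v (Finset.mem_insert_self v M)
    have h1 := Order.coheight_add_one_le (paramPrime_lt_insert_vertex K (c := c) (v := v)
      (T := T ∪ M) (Z := Z) (by simp [hvT, hv]))
    refine le_trans ?_ ih
    rw [Finset.card_insert_of_notMem hv, Finset.coe_insert, Set.union_insert]
    calc Order.coheight (paramPrime K (insert v (T ∪ ↑M)) Z c) + ((M.card + 1 : ℕ) : ℕ∞)
        = (Order.coheight (paramPrime K (insert v (T ∪ ↑M)) Z c) + 1) + M.card := by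
          push_cast; ring
      _ ≤ _ := by gcongr

lemma height_add_coheight_le [Fintype V] (p : PrimeSpectrum (PolyRing K V)) :
    Order.height p + Order.coheight p ≤ ((2 * Fintype.card V : ℕ) : ℕ∞) := by
  have h : ringKrullDim (PolyRing K V) = ((2 * Fintype.card V : ℕ) : ℕ∞) := by
    rw [MvPolynomial.ringKrullDim_of_isNoetherianRing]
    simp [two_mul]
  rw [ringKrullDim, Order.krullDim_eq_iSup_height_add_coheight_of_nonempty,
    WithBot.coe_inj] at h
  rw [← h]
  exact le_iSup (fun p : PrimeSpectrum (PolyRing K V) => Order.height p + Order.coheight p) p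

/-- The height and the coheight of `paramPrime K T ∅ c`, when `c` is a choice of representatives
that fixes `T`. -/
theorem height_coheight_paramPrime [Fintype V] (T : Finset V) (c : V → V)
    (hcc : ∀ v, c (c v) = c v) (hcT : ∀ v, c v ∈ T ↔ v ∈ T) (hT : ∀ v ∈ T, c v = v) (k : ℕ)
    (hk : (Finset.univ.filter fun v => v ∉ T ∧ c v = v).card = k) :
    Order.height (paramPrime K (T : Set V) ∅ c) = ((T.card + (Fintype.card V - k) : ℕ) : ℕ∞) ∧
    Order.coheight (paramPrime K (T : Set V) ∅ c) =
      ((Fintype.card V - T.card + k : ℕ) : ℕ∞) ∧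
    T.card + k ≤ Fintype.card V := by
  set N : Finset V := Finset.univ.filter fun v => c v ≠ v with hN
  set R : Finset V := Finset.univ.filter fun v => v ∉ T ∧ c v = v with hR
  have hNc : (fun v => if v ∈ N then c v else v) = c := by
    funext v
    by_cases hv : c v = v <;> simp [hN, hv]
  have h1 := card_add_card_le_height_paramPrime K T N c hcc hcT hT (fun v hv => by
    simpa [hN] using hv)
  rw [hNc] at h1
  have hcard : T.card + N.card + R.card = Fintype.card V := by
    have d1 : Disjoint T N := Finset.disjoint_left.2 fun v hv h => by
      simp [hN, hT v hv] at h
    have d2 : Disjoint (T ∪ N) R := Finset.disjoint_left.2 fun v hv h => by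
      simp only [hR, hN, Finset.mem_union, Finset.mem_filter, Finset.mem_univ, true_and] at hv h
      tauto
    rw [← Finset.card_union_of_disjoint d1, ← Finset.card_union_of_disjoint d2,
      ← Finset.card_univ]
    congr 1
    ext v
    simp only [hR, hN, Finset.mem_union, Finset.mem_filter, Finset.mem_univ, true_and]
    tauto
  -- Going up: the non-representatives `N` are killed at one step each, then the representatives `R`
  -- at two steps each. Surviving labels all lie in `R`, so `Z` may be taken to be its complement
  -- from the start.
  have h2 : ((2 * R.card + N.card : ℕ) : ℕ∞) ≤ Order.coheight (paramPrime K (T : Set V) ∅ c) := by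
    have e1 : paramPrime K (T : Set V) ∅ c = paramPrime K T (R : Set V)ᶜ c :=
      paramPrime_congr K fun v hv => by
        simpa [hR, hcc, hcT] using hv
    have e2 : (T : Set V) ∪ N = (R : Set V)ᶜ := by
      ext v
      simp [hR, hN]
      tauto
    have h3 := coheight_paramPrime_union K (T : Set V) (R : Set V)ᶜ N c (fun v hv h => by
      simp [hN, hT v h] at hv)
    rw [e2] at h3
    rw [e1]
    refine le_trans ?_ h3
    push_cast
    gcongr
    exact_mod_cast two_mul_card_le_coheight_paramPrime K R c fun v hv => by
      simp [hR] at hv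
      exact hv.2
  -- The lower bounds `2|T| + |N|` and `2|R| + |N|` sum to `2|V|`, so both are equalities.
  have h3 := height_add_coheight_le K (paramPrime K (T : Set V) ∅ c)
  generalize Order.height (paramPrime K (T : Set V) ∅ c) = a at *
  generalize Order.coheight (paramPrime K (T : Set V) ∅ c) = b at *
  have ha : a ≠ ⊤ := by
    rintro rfl
    exact absurd h3 (by simpa using ENat.natCast_ne_top (2 * Fintype.card V))
  have hb : b ≠ ⊤ := by
    rintro rfl
    exact absurd h3 (by simpa using ENat.natCast_ne_top (2 * Fintype.card V))
  lift a to ℕ using ha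
  lift b to ℕ using hb
  norm_cast at *
  rw [hk] at hcard h2
  omega

end ParametrizedPrimes

/-! ### Primes above the binomial edge ideal -/

section MinimalPrimes

open MvPolynomial
open scoped Classical

variable {K : Type*} [Field K] {V : Type*}

/-- The number of connected components of `G` after deleting `T`. -/
noncomputable def deletedComponents (G : SimpleGraph V) (T : Set V) : ℕ :=
  numComponents (G.induce Tᶜ)

lemma binomialEdgeIdeal_le_iff {G : SimpleGraph V} {I : Ideal (PolyRing K V)} :
    binomialEdgeIdeal K G ≤ I ↔
      ∀ u v, G.Adj u v → xVar K u * yVar K v - xVar K v * yVar K u ∈ I := by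
  rw [binomialEdgeIdeal, Ideal.span_le]
  constructor
  · intro h u v huv
    exact h ⟨u, v, huv, rfl⟩
  · rintro h _ ⟨u, v, huv, rfl⟩
    exact h u v huv

lemma primeOf_le_iff {G : SimpleGraph V} {T : Set V} {I : Ideal (PolyRing K V)} :
    primeOf K G T ≤ I ↔ (∀ v ∈ T, xVar K v ∈ I ∧ yVar K v ∈ I) ∧
      ∀ u v : (Tᶜ : Set V), (G.induce Tᶜ).Reachable u v →
        xVar K (u : V) * yVar K (v : V) - xVar K (v : V) * yVar K (u : V) ∈ I := by
  rw [primeOf, sup_le_iff, iSup_le_iff, Ideal.span_le]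
  refine and_congr ⟨fun h v hv => ⟨h ⟨v, hv, Or.inl rfl⟩, h ⟨v, hv, Or.inr rfl⟩⟩, ?_⟩ ?_
  · rintro h _ ⟨v, hv, rfl | rfl⟩
    exacts [(h v hv).1, (h v hv).2]
  · simp only [binomialEdgeIdeal_le_iff]
    constructor
    · intro h u v huv
      by_cases hne : (u : V) = v
      · rw [hne, sub_self]
        exact I.zero_mem
      · refine h ((G.induce Tᶜ).connectedComponentMk u) u v ?_
        simp only [SimpleGraph.map_adj, SimpleGraph.top_adj]
        refine ⟨⟨u, u, rfl, rfl⟩, ⟨v, v, ?_, rfl⟩, ?_, rfl, rfl⟩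
        · exact SimpleGraph.ConnectedComponent.sound huv.symm
        · simpa [Subtype.ext_iff] using hne
    · intro h C u v huv
      simp only [SimpleGraph.map_adj, SimpleGraph.top_adj] at huv
      obtain ⟨⟨_, u', hu', rfl⟩, ⟨_, v', hv', rfl⟩, -, rfl, rfl⟩ := huv
      exact h u' v' (SimpleGraph.ConnectedComponent.exact (hu'.trans hv'.symm))

lemma binomialEdgeIdeal_le_primeOf (G : SimpleGraph V) (T : Set V) :
    binomialEdgeIdeal K G ≤ primeOf K G T := by
  rw [binomialEdgeIdeal_le_iff]
  intro u v huv
  obtain ⟨h1, h2⟩ := primeOf_le_iff.1 (le_refl (primeOf K G T))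
  by_cases hu : u ∈ T
  · exact sub_mem (Ideal.mul_mem_right _ _ (h1 u hu).1) (Ideal.mul_mem_left _ _ (h1 u hu).2)
  by_cases hv : v ∈ T
  · exact sub_mem (Ideal.mul_mem_left _ _ (h1 v hv).2) (Ideal.mul_mem_right _ _ (h1 v hv).1)
  · exact h2 ⟨u, hu⟩ ⟨v, hv⟩ (SimpleGraph.Adj.reachable huv)

lemma exists_primeOf_le (G : SimpleGraph V) (p : Ideal (PolyRing K V)) [hp : p.IsPrime]
    (h : binomialEdgeIdeal K G ≤ p) : ∃ T : Set V, primeOf K G T ≤ p := by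
  rw [binomialEdgeIdeal_le_iff] at h
  refine ⟨{v | xVar K v ∈ p ∧ yVar K v ∈ p}, primeOf_le_iff.2 ⟨fun v hv => hv, ?_⟩⟩
  rintro u v ⟨w⟩
  induction w with
  | nil => simp
  | @cons u w v huw q ih =>
    have h1 : xVar K (u : V) * yVar K (w : V) - xVar K (w : V) * yVar K (u : V) ∈ p := h _ _ huw
    have hw : ¬ (xVar K (w : V) ∈ p ∧ yVar K (w : V) ∈ p) := w.2
    -- Writing `[uv]` for the minor, `y_w [uv] = y_v [uw] + y_u [wv]`, and likewise with `x` as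
    -- multiplier; since `w ∉ T`, one of `x_w`, `y_w` can be cancelled modulo `p`.
    by_cases hx : xVar K (w : V) ∈ p
    · refine (hp.mem_or_mem (x := yVar K (w : V)) ?_).resolve_left fun hy => hw ⟨hx, hy⟩
      have := p.add_mem (p.mul_mem_left (yVar K (v : V)) h1) (p.mul_mem_left (yVar K (u : V)) ih)
      ring_nf at this ⊢
      exact this
    · refine (hp.mem_or_mem (x := xVar K (w : V)) ?_).resolve_left hx
      have := p.add_mem (p.mul_mem_left (xVar K (v : V)) h1) (p.mul_mem_left (xVar K (u : V)) ih)
      ring_nf at this ⊢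
      exact this

/-- Pairwise proportional vectors of the plane over a field are multiples of a single vector. -/
lemma exists_common_direction {ι L : Type*} [Field L] (x y : ι → L)
    (h : ∀ u v, x u * y v - x v * y u = 0) :
    ∃ a b : L, ∀ v, ∃ s, x v = s * a ∧ y v = s * b := by
  by_cases h0 : ∀ v, x v = 0 ∧ y v = 0
  · exact ⟨0, 0, fun v => ⟨0, by simpa using h0 v⟩⟩
  · push Not at h0
    obtain ⟨u, hu⟩ := h0
    refine ⟨x u, y u, fun v => ?_⟩
    have hv := h u v
    by_cases hx : x u = 0
    · have hy := hu hx
      refine ⟨y v / y u, ?_, by field_simp⟩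
      rw [hx] at hv ⊢
      have : x v * y u = 0 := by linear_combination -hv
      simpa [hy] using this
    · refine ⟨x v / x u, by field_simp, ?_⟩
      field_simp
      linear_combination hv

/-- Over the fraction field of the quotient by `p`, the vectors `(x_v, y_v)` with one label are
pairwise proportional, hence multiples `s_v (a_l, b_l)` of one vector. So the quotient map factors
through `paramMap`. -/
lemma paramPrime_le_of_minor_mem (T : Set V) (c : V → V) (p : PrimeSpectrum (PolyRing K V))
    (h1 : ∀ v ∈ T, xVar K v ∈ p.asIdeal ∧ yVar K v ∈ p.asIdeal)
    (h2 : ∀ u v, u ∉ T → v ∉ T → c u = c v →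
      xVar K u * yVar K v - xVar K v * yVar K u ∈ p.asIdeal) :
    paramPrime K T ∅ c ≤ p := by
  let L := FractionRing (PolyRing K V ⧸ p.asIdeal)
  let π : PolyRing K V →ₐ[K] L :=
    (IsScalarTower.toAlgHom K (PolyRing K V ⧸ p.asIdeal) L).comp (Ideal.Quotient.mkₐ K p.asIdeal)
  have hπ : ∀ f, π f = 0 ↔ f ∈ p.asIdeal := by
    intro f
    rw [← Ideal.Quotient.eq_zero_iff_mem]
    exact (IsFractionRing.injective (PolyRing K V ⧸ p.asIdeal) L).eq_iff' (map_zero _)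
  have key : ∀ l : V, ∃ a b : L, ∀ v : {v : V // v ∉ T ∧ c v = l},
      ∃ s, π (xVar K v.1) = s * a ∧ π (yVar K v.1) = s * b := fun l =>
    exists_common_direction _ _ fun u v => by
      rw [← map_mul, ← map_mul, ← map_sub, hπ]
      exact h2 _ _ u.2.1 v.2.1 (u.2.2.trans v.2.2.symm)
  choose a b hab using key
  have hs : ∀ v, ∃ s, v ∉ T → π (xVar K v) = s * a (c v) ∧ π (yVar K v) = s * b (c v) := by
    intro v
    by_cases hv : v ∈ T
    · exact ⟨0, fun h => absurd hv h⟩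
    · obtain ⟨s, hs⟩ := hab (c v) ⟨v, hv, rfl⟩
      exact ⟨s, fun _ => hs⟩
  choose s hs using hs
  have hfac : (aeval (Sum.elim s (Sum.elim a b))).comp (paramMap K T ∅ c) = π := by
    refine MvPolynomial.algHom_ext fun i => ?_
    rcases i with v | v
    · change aeval (Sum.elim s (Sum.elim a b)) (paramMap K T ∅ c (xVar K v)) = π (xVar K v)
      by_cases hv : v ∈ T
      · simp [hv, (hπ _).2 (h1 v hv).1]
      · simp [hv, hs v hv]
    · change aeval (Sum.elim s (Sum.elim a b)) (paramMap K T ∅ c (yVar K v)) = π (yVar K v)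
      by_cases hv : v ∈ T
      · simp [hv, (hπ _).2 (h1 v hv).2]
      · simp [hv, hs v hv]
  intro f hf
  have hf : paramMap K T ∅ c f = 0 := hf
  change f ∈ p.asIdeal
  rw [← hπ, ← hfac, AlgHom.comp_apply, hf, map_zero]

/-- A choice of representatives of the connected components of `G` after deleting `T`, extended by
the identity on `T`. -/
noncomputable def componentRep (G : SimpleGraph V) (T : Set V) (v : V) : V :=
  if h : v ∈ T then v else
    ((Quot.out ((G.induce Tᶜ).connectedComponentMk ⟨v, h⟩) : (Tᶜ : Set V)) : V)

lemma componentRep_of_mem (G : SimpleGraph V) {T : Set V} {v : V} (h : v ∈ T) :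
    componentRep G T v = v := by
  simp [componentRep, h]

lemma componentRep_of_notMem (G : SimpleGraph V) {T : Set V} {v : V} (h : v ∉ T) :
    componentRep G T v =
      (Quot.out ((G.induce Tᶜ).connectedComponentMk ⟨v, h⟩) : (Tᶜ : Set V)) := by
  simp [componentRep, h]

lemma componentRep_mem_iff (G : SimpleGraph V) (T : Set V) (v : V) :
    componentRep G T v ∈ T ↔ v ∈ T := by
  by_cases h : v ∈ T
  · simp [componentRep_of_mem G h]
  · rw [componentRep_of_notMem G h]
    exact iff_of_false
      (Quot.out ((G.induce Tᶜ).connectedComponentMk ⟨v, h⟩) : (Tᶜ : Set V)).2 h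

lemma connectedComponentMk_out {W : Type*} {G : SimpleGraph W} (C : G.ConnectedComponent) :
    G.connectedComponentMk (Quot.out C) = C := Quot.out_eq C

lemma componentRep_componentRep (G : SimpleGraph V) (T : Set V) (v : V) :
    componentRep G T (componentRep G T v) = componentRep G T v := by
  by_cases h : v ∈ T
  · simp [componentRep_of_mem G h]
  · rw [componentRep_of_notMem G (mt (componentRep_mem_iff G T v).1 h)]
    simp only [componentRep_of_notMem G h]
    rw [Subtype.coe_eta, connectedComponentMk_out]

lemma componentRep_eq_iff (G : SimpleGraph V) {T : Set V} {u v : V} (hu : u ∉ T) (hv : v ∉ T) :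
    componentRep G T u = componentRep G T v ↔ (G.induce Tᶜ).Reachable ⟨u, hu⟩ ⟨v, hv⟩ := by
  rw [componentRep_of_notMem G hu, componentRep_of_notMem G hv, Subtype.coe_inj,
    ← SimpleGraph.ConnectedComponent.eq]
  refine ⟨fun h => ?_, fun h => by rw [h]⟩
  rw [← connectedComponentMk_out ((G.induce Tᶜ).connectedComponentMk ⟨u, hu⟩), h,
    connectedComponentMk_out]

lemma card_fixed_componentRep [Fintype V] (G : SimpleGraph V) (T : Finset V) :
    (Finset.univ.filter fun v => v ∉ T ∧ componentRep G (T : Set V) v = v).card =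
      deletedComponents G (T : Set V) := by
  rw [deletedComponents, numComponents, ← Fintype.card_subtype, ← Nat.card_eq_fintype_card]
  refine Nat.card_congr
    { toFun := fun v => (G.induce (T : Set V)ᶜ).connectedComponentMk ⟨v.1, v.2.1⟩
      invFun := fun C => ⟨(Quot.out C : ((T : Set V)ᶜ : Set V)), (Quot.out C).2, ?_⟩
      left_inv := fun v => Subtype.ext ?_
      right_inv := fun C => connectedComponentMk_out C }
  · rw [componentRep_of_notMem G (Quot.out C).2, Subtype.coe_eta, connectedComponentMk_out]
  · exact (componentRep_of_notMem G (T := (T : Set V)) v.2.1).symm.trans v.2.2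

/-- This identifies the zero locus of `P_T(G)` with the primes above a single prime, which is all
that height and dimension depend on. -/
lemma primeOf_le_iff_paramPrime_le (G : SimpleGraph V) (T : Set V)
    (p : PrimeSpectrum (PolyRing K V)) :
    primeOf K G T ≤ p.asIdeal ↔ paramPrime K T ∅ (componentRep G T) ≤ p := by
  constructor
  · intro h
    obtain ⟨h1, h2⟩ := primeOf_le_iff.1 h
    exact paramPrime_le_of_minor_mem T _ p h1 fun u v hu hv huv =>
      h2 ⟨u, hu⟩ ⟨v, hv⟩ ((componentRep_eq_iff G hu hv).1 huv)
  · intro h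
    refine le_trans (primeOf_le_iff.2 ⟨fun v hv => ?_, fun u v huv => ?_⟩) h
    · simp [mem_paramPrime, hv]
    · exact minor_mem_paramPrime K ((componentRep_eq_iff G u.2 v.2).2 huv)

lemma height_eq_of_le_iff {R : Type*} [CommRing R] (I : Ideal R) (q : PrimeSpectrum R)
    (h : ∀ p : PrimeSpectrum R, I ≤ p.asIdeal ↔ q ≤ p) : I.height = Order.height q := by
  rw [← PrimeSpectrum.height_eq_orderHeight]
  refine le_antisymm (Ideal.height_mono ((h q).2 le_rfl)) ?_
  rw [I.height_eq_inf_minimalPrimes]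
  exact le_iInf₂ fun J hJ => Ideal.height_mono ((h ⟨J, hJ.1.1⟩).1 hJ.1.2)

lemma ringKrullDim_quotient_eq_of_le_iff {R : Type*} [CommRing R] (I : Ideal R)
    (q : PrimeSpectrum R) (h : ∀ p : PrimeSpectrum R, I ≤ p.asIdeal ↔ q ≤ p) :
    ringKrullDim (R ⧸ I) = Order.coheight q := by
  have hq : PrimeSpectrum.zeroLocus (I : Set R) = Set.Ici q := Set.ext h
  rw [ringKrullDim_quotient, Order.coheight_eq_krullDim_Ici, hq]

lemma ringKrullDim_quotient_le {R : Type*} [CommRing R] (I : Ideal R) (d : ℕ∞)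
    (h : ∀ p : PrimeSpectrum R, I ≤ p.asIdeal → Order.coheight p ≤ d) :
    ringKrullDim (R ⧸ I) ≤ d := by
  rw [ringKrullDim_quotient]
  refine iSup_le fun l => ?_
  have h1 := Order.length_le_coheight_head
    (p := l.map (fun x : PrimeSpectrum.zeroLocus (I : Set R) => x.1) fun _ _ h => h)
  have h2 := h l.head.1 l.head.2
  exact WithBot.coe_le_coe.2 (h1.trans h2)

theorem ncard_add_deletedComponents_le [Fintype V] (G : SimpleGraph V) (T : Set V) :
    T.ncard + deletedComponents G T ≤ Fintype.card V := by
  lift T to Finset V using T.toFinite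
  rw [Set.ncard_coe_finset]
  -- The inequality is combinatorial; any field would serve.
  exact (height_coheight_paramPrime ℚ T _ (componentRep_componentRep G T)
    (componentRep_mem_iff G T) (fun _ => componentRep_of_mem G) _
    (card_fixed_componentRep G T)).2.2

lemma coheight_paramPrime_componentRep [Fintype V] (G : SimpleGraph V) (T : Set V) :
    Order.coheight (paramPrime K T ∅ (componentRep G T)) =
      ((Fintype.card V - T.ncard + deletedComponents G T : ℕ) : ℕ∞) := by
  lift T to Finset V using T.toFinite
  rw [Set.ncard_coe_finset]
  exact (height_coheight_paramPrime K T _ (componentRep_componentRep G T)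
    (componentRep_mem_iff G T) (fun _ => componentRep_of_mem G) _
    (card_fixed_componentRep G T)).2.1

theorem height_primeOf [Fintype V] (G : SimpleGraph V) (T : Set V) :
    (primeOf K G T).height =
      ((T.ncard + (Fintype.card V - deletedComponents G T) : ℕ) : ℕ∞) := by
  rw [height_eq_of_le_iff _ _ (primeOf_le_iff_paramPrime_le G T)]
  lift T to Finset V using T.toFinite
  rw [Set.ncard_coe_finset]
  exact (height_coheight_paramPrime K T _ (componentRep_componentRep G T)
    (componentRep_mem_iff G T) (fun _ => componentRep_of_mem G) _ (card_fixed_componentRep G T)).1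

theorem ringKrullDim_quotient_primeOf [Fintype V] (G : SimpleGraph V) (T : Set V) :
    ringKrullDim (PolyRing K V ⧸ primeOf K G T) =
      ((Fintype.card V - T.ncard + deletedComponents G T : ℕ) : WithBot ℕ∞) := by
  rw [ringKrullDim_quotient_eq_of_le_iff _ _ (primeOf_le_iff_paramPrime_le G T),
    coheight_paramPrime_componentRep]
  rfl

/-- There is a set `T` for which `T.ncard - deletedComponents G T` is minimal, and the height and
the dimension of the binomial edge ideal are those of `P_T(G)`. -/
theorem exists_height_binomialEdgeIdeal (K : Type*) [Field K] [Fintype V] (G : SimpleGraph V) :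
    ∃ T : Set V,
      (binomialEdgeIdeal K G).height =
        ((T.ncard + (Fintype.card V - deletedComponents G T) : ℕ) : ℕ∞) ∧
      ringKrullDim (PolyRing K V ⧸ binomialEdgeIdeal K G) =
        ((Fintype.card V - T.ncard + deletedComponents G T : ℕ) : WithBot ℕ∞) ∧
      ∀ T' : Set V, T.ncard + deletedComponents G T' ≤ T'.ncard + deletedComponents G T := by
  obtain ⟨T, hT⟩ := Finite.exists_min fun T : Set V =>
    T.ncard + (Fintype.card V - deletedComponents G T)
  -- Additive form without truncated subtraction; it serves both the minimal height and the maximal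
  -- dimension.
  have hmin : ∀ T' : Set V,
      T.ncard + deletedComponents G T' ≤ T'.ncard + deletedComponents G T := fun T' => by
    have h1 := hT T'
    have h2 := ncard_add_deletedComponents_le G T
    have h3 := ncard_add_deletedComponents_le G T'
    omega
  refine ⟨T, le_antisymm ?_ ?_, le_antisymm ?_ ?_, hmin⟩
  · rw [← height_primeOf (K := K)]
    exact Ideal.height_mono (binomialEdgeIdeal_le_primeOf G _)
  · rw [(binomialEdgeIdeal K G).height_eq_inf_minimalPrimes]
    refine le_iInf₂ fun J hJ => ?_
    have := hJ.1.1
    obtain ⟨T', hT'⟩ := exists_primeOf_le G J hJ.1.2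
    refine le_trans ?_ (Ideal.height_mono hT')
    rw [height_primeOf]
    exact_mod_cast hT T'
  · refine ringKrullDim_quotient_le _ _ fun p hp => ?_
    obtain ⟨T', hT'⟩ := exists_primeOf_le G p.asIdeal hp
    refine (Order.coheight_anti ((primeOf_le_iff_paramPrime_le G _ p).1 hT')).trans ?_
    rw [coheight_paramPrime_componentRep]
    have h1 := hmin T'
    have h2 := ncard_add_deletedComponents_le G T
    have h3 := ncard_add_deletedComponents_le G T'
    exact Nat.cast_le.2 (by omega)
  · rw [← ringKrullDim_quotient_primeOf (K := K)]
    exact ringKrullDim_le_of_surjective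
      (Ideal.Quotient.factor (binomialEdgeIdeal_le_primeOf G T))
      (Ideal.Quotient.factor_surjective _)

end MinimalPrimes

/-! ### Cut sets of joins and of disjoint unions -/

section CutSets

variable {V W : Type*}

lemma numComponents_congr {G : SimpleGraph V} {H : SimpleGraph W} (e : G ≃g H) :
    numComponents G = numComponents H :=
  Nat.card_congr e.connectedComponentEquiv

lemma deletedComponents_univ (G : SimpleGraph V) : deletedComponents G Set.univ = 0 := by
  have : IsEmpty (Set.univᶜ : Set V) := by simp
  have : IsEmpty (G.induce Set.univᶜ).ConnectedComponent := ⟨fun C => by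
    induction C using SimpleGraph.ConnectedComponent.ind with
    | h v => exact isEmptyElim v⟩
  rw [deletedComponents, numComponents, Nat.card_of_isEmpty]

lemma deletedComponents_pos [Finite V] (G : SimpleGraph V) {T : Set V} {v : V} (hv : v ∉ T) :
    0 < deletedComponents G T :=
  have : Nonempty (G.induce Tᶜ).ConnectedComponent :=
    ⟨(G.induce Tᶜ).connectedComponentMk ⟨v, hv⟩⟩
  Nat.card_pos

lemma deletedComponents_eq_one {G : SimpleGraph V} {T : Set V} (h : (G.induce Tᶜ).Connected) :
    deletedComponents G T = 1 := by
  have := h.preconnected.subsingleton_connectedComponent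
  have := h.nonempty
  have : Nonempty (G.induce Tᶜ).ConnectedComponent := inferInstance
  exact Nat.card_eq_one_iff_unique.2 ⟨inferInstance, inferInstance⟩

lemma deletedComponents_empty {G : SimpleGraph V} (h : G.Connected) :
    deletedComponents G ∅ = 1 := by
  apply deletedComponents_eq_one
  rw [Set.compl_empty]
  exact (SimpleGraph.induceUnivIso G).connected_iff.2 h

/-- Restoring `v` amounts to deleting `T \ {v}` instead of `T`, so everything can be expressed by
component counts. -/
lemma hasCutPointProperty_iff {G : SimpleGraph V} {T : Set V} :
    HasCutPointProperty G T ↔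
      ∀ v ∈ T, deletedComponents G (T \ {v}) < deletedComponents G T := by
  refine forall₂_congr fun v hv => ?_
  rw [IsCutPoint, deletedComponents, deletedComponents]
  have h1 : (T \ {v})ᶜ = insert v Tᶜ := by
    ext w
    simp only [Set.mem_compl_iff, Set.mem_sdiff, Set.mem_singleton_iff, Set.mem_insert_iff]
    tauto
  have h2 : numComponents ((G.induce (insert v Tᶜ)).induce
      ({⟨v, Set.mem_insert v Tᶜ⟩}ᶜ : Set (insert v Tᶜ : Set V))) = numComponents (G.induce Tᶜ) :=
    numComponents_congr
      { toFun := fun w => ⟨w.1.1, w.1.2.resolve_left fun h => w.2 (Subtype.ext h)⟩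
        invFun := fun w => ⟨⟨w.1, Or.inr w.2⟩, fun h => w.2 (by
          have h : w.1 = v := congrArg Subtype.val h
          rwa [h])⟩
        left_inv := fun _ => rfl
        right_inv := fun _ => rfl
        map_rel_iff' := Iff.rfl }
  rw [h1, h2]

lemma mem_cutSets_iff {G : SimpleGraph V} {T : Set V} :
    T ∈ cutSets G ↔ HasCutPointProperty G T := by
  constructor
  · rintro (rfl | h)
    · exact fun v hv => hv.elim
    · exact h
  · exact Or.inr

lemma HasCutPointProperty.exists_notMem [Nonempty V] {G : SimpleGraph V} {T : Set V}
    (h : HasCutPointProperty G T) : ∃ v, v ∉ T := by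
  by_contra! hT
  obtain rfl : T = Set.univ := Set.eq_univ_of_forall hT
  obtain ⟨v⟩ := ‹Nonempty V›
  have := hasCutPointProperty_iff.1 h v trivial
  rw [deletedComponents_univ] at this
  omega

/-- For a connected graph, the nonempty sets with the cut point property are those that leave at
least two components. -/
lemma HasCutPointProperty.two_le_iff [Finite V] {G : SimpleGraph V} (hG : G.Connected) {T : Set V}
    (h : HasCutPointProperty G T) : 2 ≤ deletedComponents G T ↔ T ≠ ∅ := by
  constructor
  · rintro h2 rfl
    rw [deletedComponents_empty hG] at h2
    omega
  · intro hT
    obtain ⟨v, hv⟩ := Set.nonempty_iff_ne_empty.2 hT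
    have h1 := hasCutPointProperty_iff.1 h v hv
    have h2 := deletedComponents_pos G (T := T \ {v}) (v := v) (by simp)
    omega

section Join

variable (G : SimpleGraph V) (H : SimpleGraph W)

@[simp] lemma graphJoin_adj_inl_inl {u v : V} :
    (graphJoin G H).Adj (Sum.inl u) (Sum.inl v) ↔ G.Adj u v := by simp [graphJoin]

@[simp] lemma graphJoin_adj_inr_inr {u v : W} :
    (graphJoin G H).Adj (Sum.inr u) (Sum.inr v) ↔ H.Adj u v := by simp [graphJoin]

@[simp] lemma graphJoin_adj_inl_inr {u : V} {v : W} :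
    (graphJoin G H).Adj (Sum.inl u) (Sum.inr v) := by simp [graphJoin]

@[simp] lemma graphJoin_adj_inr_inl {u : V} {v : W} :
    (graphJoin G H).Adj (Sum.inr v) (Sum.inl u) := by simp [graphJoin]

lemma deletedComponents_graphJoin_left (T : Set W) :
    deletedComponents (graphJoin G H) (Set.range Sum.inl ∪ Sum.inr '' T) =
      deletedComponents H T := by
  refine (numComponents_congr (RelIso.mk (Equiv.ofBijective
    (fun w : (Tᶜ : Set W) => (⟨Sum.inr w.1, by have h : w.1 ∉ T := w.2; simp [h]⟩ :
      ((Set.range Sum.inl ∪ Sum.inr '' T)ᶜ : Set (V ⊕ W)))) ⟨?_, ?_⟩) ?_)).symm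
  · intro a b h
    simpa [Subtype.ext_iff] using h
  · rintro ⟨v | w, h⟩
    · simp at h
    · exact ⟨⟨w, by simpa using h⟩, rfl⟩
  · intro a b
    exact graphJoin_adj_inr_inr G H

lemma deletedComponents_graphJoin_right (T : Set V) :
    deletedComponents (graphJoin G H) (Sum.inl '' T ∪ Set.range Sum.inr) =
      deletedComponents G T := by
  refine (numComponents_congr (RelIso.mk (Equiv.ofBijective
    (fun w : (Tᶜ : Set V) => (⟨Sum.inl w.1, by have h : w.1 ∉ T := w.2; simp [h]⟩ :
      ((Sum.inl '' T ∪ Set.range Sum.inr)ᶜ : Set (V ⊕ W)))) ⟨?_, ?_⟩) ?_)).symm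
  · intro a b h
    simpa [Subtype.ext_iff] using h
  · rintro ⟨v | w, h⟩
    · exact ⟨⟨v, by simpa using h⟩, rfl⟩
    · simp at h
  · intro a b
    exact graphJoin_adj_inl_inl G H

/-- The surviving `v` and `w` are adjacent, and each is adjacent to every survivor of the opposite
side. -/
lemma deletedComponents_graphJoin_eq_one {T : Set (V ⊕ W)} {v : V} {w : W}
    (hv : Sum.inl v ∉ T) (hw : Sum.inr w ∉ T) : deletedComponents (graphJoin G H) T = 1 := by
  apply deletedComponents_eq_one
  have hadj : ((graphJoin G H).induce Tᶜ).Adj ⟨Sum.inl v, hv⟩ ⟨Sum.inr w, hw⟩ :=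
    graphJoin_adj_inl_inr G H
  have key : ∀ x, ((graphJoin G H).induce Tᶜ).Reachable x ⟨Sum.inl v, hv⟩ := by
    rintro ⟨u | u, hu⟩
    · have h : ((graphJoin G H).induce Tᶜ).Adj ⟨Sum.inl u, hu⟩ ⟨Sum.inr w, hw⟩ :=
        graphJoin_adj_inl_inr G H
      exact h.reachable.trans hadj.symm.reachable
    · have h : ((graphJoin G H).induce Tᶜ).Adj ⟨Sum.inr u, hu⟩ ⟨Sum.inl v, hv⟩ :=
        graphJoin_adj_inr_inl G H
      exact h.reachable
  exact (SimpleGraph.connected_iff _).2 ⟨fun x y => (key x).trans (key y).symm, ⟨⟨_, hv⟩⟩⟩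

/-- The vertices in `T` test the property within `H`. Restoring a vertex of the fully deleted side
connects everything, so it is a cut point exactly when at least two components were left. -/
lemma hasCutPointProperty_graphJoin_left [Nonempty V] (T : Set W) :
    HasCutPointProperty (graphJoin G H) (Set.range Sum.inl ∪ Sum.inr '' T) ↔
      HasCutPointProperty H T ∧ 2 ≤ deletedComponents H T := by
  have hw (w : W) (h : w ∈ T) : ((Set.range Sum.inl ∪ Sum.inr '' T) \ {Sum.inr w} : Set (V ⊕ W)) =
      Set.range Sum.inl ∪ Sum.inr '' (T \ {w}) := by
    ext (x | x) <;> simp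
  rw [hasCutPointProperty_iff, hasCutPointProperty_iff, deletedComponents_graphJoin_left]
  constructor
  · intro h
    refine ⟨fun w hwT => ?_, ?_⟩
    · have := h (Sum.inr w) (by simp [hwT])
      rwa [hw w hwT, deletedComponents_graphJoin_left] at this
    · obtain ⟨v⟩ := ‹Nonempty V›
      have h1 := h (Sum.inl v) (by simp)
      by_cases hT : T = Set.univ
      · rw [hT, deletedComponents_univ] at h1
        omega
      · obtain ⟨w, hwT⟩ := (Set.ne_univ_iff_exists_notMem T).1 hT
        rw [deletedComponents_graphJoin_eq_one G H (v := v) (w := w) (by simp)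
          (by simp [hwT])] at h1
        omega
  · rintro ⟨h, h2⟩ (v | w) hv
    · have hT : T ≠ Set.univ := by
        rintro rfl
        rw [deletedComponents_univ] at h2
        omega
      obtain ⟨w, hwT⟩ := (Set.ne_univ_iff_exists_notMem T).1 hT
      rw [deletedComponents_graphJoin_eq_one G H (v := v) (w := w) (by simp) (by simp [hwT])]
      omega
    · have hwT : w ∈ T := by simpa using hv
      rw [hw w hwT, deletedComponents_graphJoin_left]
      exact h w hwT

lemma hasCutPointProperty_graphJoin_right [Nonempty W] (T : Set V) :
    HasCutPointProperty (graphJoin G H) (Sum.inl '' T ∪ Set.range Sum.inr) ↔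
      HasCutPointProperty G T ∧ 2 ≤ deletedComponents G T := by
  have hv (v : V) (h : v ∈ T) : ((Sum.inl '' T ∪ Set.range Sum.inr) \ {Sum.inl v} : Set (V ⊕ W)) =
      Sum.inl '' (T \ {v}) ∪ Set.range Sum.inr := by
    ext (x | x) <;> simp
  rw [hasCutPointProperty_iff, hasCutPointProperty_iff, deletedComponents_graphJoin_right]
  constructor
  · intro h
    refine ⟨fun v hvT => ?_, ?_⟩
    · have := h (Sum.inl v) (by simp [hvT])
      rwa [hv v hvT, deletedComponents_graphJoin_right] at this
    · obtain ⟨w⟩ := ‹Nonempty W›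
      have h1 := h (Sum.inr w) (by simp)
      by_cases hT : T = Set.univ
      · rw [hT, deletedComponents_univ] at h1
        omega
      · obtain ⟨v, hvT⟩ := (Set.ne_univ_iff_exists_notMem T).1 hT
        rw [deletedComponents_graphJoin_eq_one G H (v := v) (w := w) (by simp [hvT])
          (by simp)] at h1
        omega
  · rintro ⟨h, h2⟩ (v | w) hw
    · have hvT : v ∈ T := by simpa using hw
      rw [hv v hvT, deletedComponents_graphJoin_right]
      exact h v hvT
    · have hT : T ≠ Set.univ := by
        rintro rfl
        rw [deletedComponents_univ] at h2
        omega
      obtain ⟨v, hvT⟩ := (Set.ne_univ_iff_exists_notMem T).1 hT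
      rw [deletedComponents_graphJoin_eq_one G H (v := v) (w := w) (by simp [hvT]) (by simp)]
      omega

/-- With survivors on both sides one component is left, and restoring a vertex cannot bring the
count down to 0. -/
lemma HasCutPointProperty.range_subset_or_range_subset [Finite V] [Finite W] {T : Set (V ⊕ W)}
    (h : HasCutPointProperty (graphJoin G H) T) (hT : T ≠ ∅) :
    (∀ v, Sum.inl v ∈ T) ∨ ∀ w, Sum.inr w ∈ T := by
  by_contra! h'
  obtain ⟨⟨v, hv⟩, w, hw⟩ := h'
  obtain ⟨x, hx⟩ := Set.nonempty_iff_ne_empty.2 hT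
  have h1 := hasCutPointProperty_iff.1 h x hx
  rw [deletedComponents_graphJoin_eq_one G H hv hw] at h1
  have h2 := deletedComponents_pos (graphJoin G H) (T := T \ {x}) (v := x) (by simp)
  omega

end Join

section DisjointUnion

variable {ι : Type*} {U : ι → Type*} (H : ∀ i, SimpleGraph (U i))

@[simp] lemma disjointUnion_adj_mk {i : ι} {u v : U i} :
    (disjointUnion H).Adj ⟨i, u⟩ ⟨i, v⟩ ↔ (H i).Adj u v := by
  constructor
  · rintro ⟨j, u', v', h1, h2, h⟩
    obtain ⟨rfl, h1⟩ := Sigma.mk.inj_iff.1 h1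
    cases h1
    cases h2
    exact h
  · exact fun h => ⟨i, u, v, rfl, rfl, h⟩

lemma exists_reachable_of_disjointUnion_reachable {x y : Σ i, U i}
    (h : (disjointUnion H).Reachable x y) :
    ∃ (i : ι) (u v : U i), x = ⟨i, u⟩ ∧ y = ⟨i, v⟩ ∧ (H i).Reachable u v := by
  obtain ⟨p⟩ := h
  induction p with
  | @nil x => exact ⟨x.1, x.2, x.2, rfl, rfl, SimpleGraph.Reachable.rfl⟩
  | cons hxy p ih =>
    obtain ⟨j, a, b, rfl, rfl, hab⟩ := hxy
    obtain ⟨k, u, v, h, rfl, huv⟩ := ih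
    obtain ⟨rfl, h⟩ := Sigma.mk.inj_iff.1 h
    cases h
    exact ⟨j, a, v, rfl, rfl, hab.reachable.trans huv⟩

lemma disjointUnion_fst_eq_of_reachable {x y : Σ i, U i}
    (h : (disjointUnion H).Reachable x y) : x.1 = y.1 := by
  obtain ⟨i, u, v, rfl, rfl, -⟩ := exists_reachable_of_disjointUnion_reachable H h
  rfl

lemma reachable_of_disjointUnion_reachable_mk {i : ι} {u v : U i}
    (h : (disjointUnion H).Reachable ⟨i, u⟩ ⟨i, v⟩) : (H i).Reachable u v := by
  obtain ⟨j, a, b, h1, h2, h⟩ := exists_reachable_of_disjointUnion_reachable H h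
  obtain ⟨rfl, h1⟩ := Sigma.mk.inj_iff.1 h1
  cases h1
  cases h2
  exact h

lemma numComponents_disjointUnion [Fintype ι] [∀ i, Finite (U i)] :
    numComponents (disjointUnion H) = ∑ i, numComponents (H i) := by
  unfold numComponents
  rw [← Nat.card_sigma]
  refine (Nat.card_congr (Equiv.ofBijective (fun C : Σ i, (H i).ConnectedComponent =>
    C.2.map (⟨fun u => ⟨C.1, u⟩, fun h => (disjointUnion_adj_mk H).2 h⟩ :
      H C.1 →g disjointUnion H)) ⟨?_, ?_⟩)).symm
  · rintro ⟨i, C⟩ ⟨j, D⟩ h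
    induction C using SimpleGraph.ConnectedComponent.ind with | h u => ?_
    induction D using SimpleGraph.ConnectedComponent.ind with | h v => ?_
    have h : (disjointUnion H).Reachable ⟨i, u⟩ ⟨j, v⟩ := SimpleGraph.ConnectedComponent.exact h
    obtain rfl : i = j := disjointUnion_fst_eq_of_reachable H h
    rw [SimpleGraph.ConnectedComponent.sound (reachable_of_disjointUnion_reachable_mk H h)]
  · intro C
    induction C using SimpleGraph.ConnectedComponent.ind with | h v => ?_
    exact ⟨⟨v.1, (H v.1).connectedComponentMk v.2⟩, rfl⟩

lemma deletedComponents_disjointUnion [Fintype ι] [∀ i, Finite (U i)] (T : Set (Σ i, U i)) :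
    deletedComponents (disjointUnion H) T = ∑ i, deletedComponents (H i) (Sigma.mk i ⁻¹' T) := by
  unfold deletedComponents
  rw [← numComponents_disjointUnion]
  refine (numComponents_congr (RelIso.mk (Equiv.ofBijective
    (fun w : Σ i, ((Sigma.mk i ⁻¹' T)ᶜ : Set (U i)) =>
      (⟨⟨w.1, w.2.1⟩, w.2.2⟩ : (Tᶜ : Set (Σ i, U i)))) ⟨?_, ?_⟩) ?_)).symm
  · rintro ⟨i, a, ha⟩ ⟨j, b, hb⟩ h
    have h : (⟨i, a⟩ : Σ i, U i) = ⟨j, b⟩ := congrArg Subtype.val h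
    obtain ⟨rfl, h⟩ := Sigma.mk.inj_iff.1 h
    cases h
    rfl
  · rintro ⟨⟨i, w⟩, h⟩
    exact ⟨⟨i, w, h⟩, rfl⟩
  · rintro ⟨i, a, ha⟩ ⟨j, b, hb⟩
    by_cases hij : i = j
    · subst hij
      have h1 : (disjointUnion H).Adj ⟨i, a⟩ ⟨i, b⟩ ↔ (H i).Adj a b := disjointUnion_adj_mk H
      exact h1.trans (disjointUnion_adj_mk (fun i => (H i).induce (Sigma.mk i ⁻¹' T)ᶜ)
        (u := ⟨a, ha⟩) (v := ⟨b, hb⟩)).symm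
    · refine iff_of_false ?_ ?_
      · intro h
        exact hij (disjointUnion_fst_eq_of_reachable H
          (show (disjointUnion H).Adj ⟨i, a⟩ ⟨j, b⟩ from h).reachable)
      · intro h
        exact hij (disjointUnion_fst_eq_of_reachable _ h.reachable)

lemma ncard_sigma [Fintype ι] [∀ i, Finite (U i)] (T : Set (Σ i, U i)) :
    T.ncard = ∑ i, (Sigma.mk i ⁻¹' T).ncard := by
  simp only [← Nat.card_coe_set_eq]
  rw [← Nat.card_sigma]
  exact Nat.card_congr
    { toFun := fun w => ⟨w.1.1, w.1.2, w.2⟩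
      invFun := fun w => ⟨⟨w.1, w.2.1⟩, w.2.2⟩
      left_inv := fun _ => rfl
      right_inv := fun _ => rfl }

/-- Component counts add over the pieces, and restoring a vertex changes only the summand of its own
piece. -/
lemma hasCutPointProperty_disjointUnion [Fintype ι] [∀ i, Finite (U i)] (T : Set (Σ i, U i)) :
    HasCutPointProperty (disjointUnion H) T ↔
      ∀ i, HasCutPointProperty (H i) (Sigma.mk i ⁻¹' T) := by
  classical
  have key (i : ι) (w : U i) :
      deletedComponents (disjointUnion H) (T \ {⟨i, w⟩}) < deletedComponents (disjointUnion H) T ↔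
      deletedComponents (H i) (Sigma.mk i ⁻¹' T \ {w}) <
        deletedComponents (H i) (Sigma.mk i ⁻¹' T) := by
    rw [deletedComponents_disjointUnion, deletedComponents_disjointUnion,
      ← Finset.add_sum_erase _ _ (Finset.mem_univ i),
      ← Finset.add_sum_erase (a := i) Finset.univ
        (fun i => deletedComponents (H i) (Sigma.mk i ⁻¹' T)) (Finset.mem_univ i),
      Finset.sum_congr (s₁ := Finset.univ.erase i) rfl fun j hj => ?_, add_lt_add_iff_right]
    · have : Sigma.mk i ⁻¹' (T \ {⟨i, w⟩}) = Sigma.mk i ⁻¹' T \ {w} := by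
        ext u
        simp
      rw [this]
    · have hj : j ≠ i := Finset.ne_of_mem_erase hj
      congr 1
      ext u
      simp [hj]
  simp only [hasCutPointProperty_iff]
  constructor
  · exact fun h i w hw => (key i w).1 (h ⟨i, w⟩ hw)
  · rintro h ⟨i, w⟩ hw
    exact (key i w).2 (h i w hw)

end DisjointUnion

end CutSets

/-! ### Cut sets of the join with a disjoint union -/

section JoinWithDisjointUnion

open Set

variable {V : Type*} {r : ℕ} {W : Fin r → Type*}

lemma ncard_range_inl_union [Fintype V] {U : Type*} [Finite U] (T : Set U) :
    (range Sum.inl ∪ Sum.inr '' T : Set (V ⊕ U)).ncard = Fintype.card V + T.ncard := by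
  rw [ncard_union_eq ?_ (toFinite _) (toFinite _), ncard_image_of_injective _ Sum.inr_injective,
    ← image_univ, ncard_image_of_injective _ Sum.inl_injective, ncard_univ,
    Nat.card_eq_fintype_card]
  rw [Set.disjoint_left]
  rintro _ ⟨v, rfl⟩ ⟨w, -, h⟩
  cases h

lemma ncard_image_union_range_inr [Finite V] {U : Type*} [Fintype U] (T : Set V) :
    (Sum.inl '' T ∪ range Sum.inr : Set (V ⊕ U)).ncard = T.ncard + Fintype.card U := by
  rw [ncard_union_eq ?_ (toFinite _) (toFinite _), ncard_image_of_injective _ Sum.inl_injective,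
    ← image_univ, ncard_image_of_injective _ Sum.inr_injective, ncard_univ,
    Nat.card_eq_fintype_card]
  rw [Set.disjoint_left]
  rintro _ ⟨v, -, rfl⟩ ⟨w, h⟩
  cases h

/-- A set with the cut point property never exhausts a nonempty graph, so each of the `r ≥ 2` pieces
keeps a component. -/
lemma two_le_deletedComponents_disjointUnion (hr : 2 ≤ r) [∀ i, Finite (W i)]
    [∀ i, Nonempty (W i)] (H : ∀ i, SimpleGraph (W i)) (T : Set (Σ i, W i))
    (h : ∀ i, HasCutPointProperty (H i) (Sigma.mk i ⁻¹' T)) :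
    2 ≤ deletedComponents (disjointUnion H) T := by
  rw [deletedComponents_disjointUnion]
  calc 2 ≤ ∑ _i : Fin r, 1 := by simpa using hr
    _ ≤ _ := Finset.sum_le_sum fun i _ => by
      obtain ⟨w, hw⟩ := (h i).exists_notMem
      exact deletedComponents_pos _ hw

theorem mem_cutSets_join_iff (hr : 2 ≤ r) [Finite V] [∀ i, Finite (W i)]
    (G : SimpleGraph V) (H : ∀ i, SimpleGraph (W i)) (hG : G.Connected)
    (hH : ∀ i, (H i).Connected) (T : Set (V ⊕ Σ i, W i)) :
    T ∈ cutSets (graphJoin G (disjointUnion H)) ↔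
      T = ∅ ∨
      (∃ T' : Set (Σ i, W i), (∀ i, Sigma.mk i ⁻¹' T' ∈ cutSets (H i)) ∧
        T = range Sum.inl ∪ Sum.inr '' T') ∨
      ∃ T' ∈ nonemptyCutSets G, T = Sum.inl '' T' ∪ range Sum.inr := by
  have := hG.nonempty
  have := fun i => (hH i).nonempty
  have : Nonempty (Σ i, W i) := ⟨⟨⟨0, by omega⟩, Classical.arbitrary _⟩⟩
  simp only [nonemptyCutSets, mem_sdiff, mem_singleton_iff, mem_cutSets_iff]
  constructor
  · intro h
    by_cases hT : T = ∅
    · exact Or.inl hT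
    right
    rcases h.range_subset_or_range_subset _ _ hT with h' | h'
    · have hTeq : T = range Sum.inl ∪ Sum.inr '' (Sum.inr ⁻¹' T) := by
        ext (x | x) <;> simp [h']
      rw [hTeq, hasCutPointProperty_graphJoin_left, hasCutPointProperty_disjointUnion] at h
      exact Or.inl ⟨_, h.1, hTeq⟩
    · have hTeq : T = Sum.inl '' (Sum.inl ⁻¹' T) ∪ range Sum.inr := by
        ext (x | x) <;> simp [h']
      rw [hTeq, hasCutPointProperty_graphJoin_right] at h
      exact Or.inr ⟨_, ⟨h.1, (h.1.two_le_iff hG).1 h.2⟩, hTeq⟩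
  · rintro (rfl | ⟨T', h, rfl⟩ | ⟨T', ⟨h1, h2⟩, rfl⟩)
    · exact fun v hv => hv.elim
    · rw [hasCutPointProperty_graphJoin_left, hasCutPointProperty_disjointUnion]
      exact ⟨h, two_le_deletedComponents_disjointUnion hr H T' h⟩
    · rw [hasCutPointProperty_graphJoin_right]
      exact ⟨h1, (h1.two_le_iff hG).2 h2⟩

theorem cutSets_graphJoin_disjointUnion (hr : 2 ≤ r) [Finite V] [∀ i, Finite (W i)]
    (G : SimpleGraph V) (H : ∀ i, SimpleGraph (W i)) (hG : G.Connected)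
    (hH : ∀ i, (H i).Connected) :
    cutSets (graphJoin G (disjointUnion H)) =
      {∅} ∪
      collJoin
        (collJoinFamily fun i =>
          (fun T : Set (W i) => (fun w => Sum.inr ⟨i, w⟩) '' T) '' cutSets (H i))
        {range Sum.inl} ∪
      collJoin ((fun T : Set V => Sum.inl '' T) '' nonemptyCutSets G) {range Sum.inr} := by
  ext T
  rw [mem_cutSets_join_iff hr G H hG hH, mem_union, mem_union, or_assoc, mem_singleton_iff]
  refine or_congr_right (or_congr ?_ ?_)
  · constructor
    · rintro ⟨T', h, rfl⟩
      refine ⟨_, ⟨_, fun i => ⟨_, h i, rfl⟩, rfl⟩, _, rfl, ?_⟩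
      ext (x | ⟨i, x⟩)
      · simp
      · simp only [mem_union, mem_iUnion, mem_image, mem_range, mem_preimage]
        constructor
        · rintro (⟨y, hy⟩ | ⟨y, hy, h⟩)
          · cases hy
          · cases h
            exact Or.inl ⟨i, x, hy, rfl⟩
        · rintro (⟨j, y, hy, h⟩ | ⟨y, hy⟩)
          · cases h
            exact Or.inr ⟨_, hy, rfl⟩
          · cases hy
    · rintro ⟨_, ⟨A, hA, rfl⟩, _, rfl, rfl⟩
      choose B hB hBA using hA
      refine ⟨{x | x.2 ∈ B x.1}, hB, ?_⟩
      simp only [← hBA]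
      ext (x | ⟨i, x⟩)
      · simp
      · simp only [mem_union, mem_iUnion, mem_image, mem_range, mem_ofPred_eq]
        constructor
        · rintro (⟨j, y, hy, h⟩ | ⟨y, hy⟩)
          · cases h
            exact Or.inr ⟨_, hy, rfl⟩
          · cases hy
        · rintro (⟨y, hy⟩ | ⟨y, hy, h⟩)
          · cases hy
          · cases h
            exact Or.inl ⟨i, x, hy, rfl⟩
  · constructor
    · rintro ⟨T', h, rfl⟩
      exact ⟨_, ⟨T', h, rfl⟩, _, rfl, rfl⟩
    · rintro ⟨_, ⟨T', h, rfl⟩, _, rfl, rfl⟩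
      exact ⟨T', h, rfl⟩

/-- Passing to `T \ {v}` lowers the cardinality by one, so by minimality the component count must
drop as well. -/
lemma hasCutPointProperty_of_minimal [Finite V] (G : SimpleGraph V) (T : Set V)
    (h : ∀ T' : Set V, T.ncard + deletedComponents G T' ≤ T'.ncard + deletedComponents G T) :
    HasCutPointProperty G T := by
  rw [hasCutPointProperty_iff]
  intro v hv
  have h1 := h (T \ {v})
  have h2 := ncard_sdiff_singleton_add_one hv (toFinite T)
  omega

end JoinWithDisjointUnion

end BinomialEdge

/-! ### The three parts of the proposition -/

open BinomialEdge in
theorem proposition4p4 {K : Type*} [Field K] {r : ℕ} (hr : 2 ≤ r)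
    {V : Type*} [Fintype V] {W : Fin r → Type*} [∀ i, Fintype (W i)]
    (G₁ : SimpleGraph V) (H : ∀ i, SimpleGraph (W i))
    (hG₁ : G₁.Connected) (hH : ∀ i, (H i).Connected)
    (t n : ℕ) (N : Fin r → ℕ)
    (ht : Fintype.card V = t) (hN : ∀ i, Fintype.card (W i) = N i) (hn : n = t + ∑ i, N i) :
    -- (a)
    cutSets (graphJoin G₁ (disjointUnion H)) =
        {∅} ∪
        collJoin
          (collJoinFamily fun i =>
            (fun T : Set (W i) => (fun w => Sum.inr ⟨i, w⟩) '' T) '' cutSets (H i))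
          {Set.range Sum.inl} ∪
        collJoin ((fun T : Set V => Sum.inl '' T) '' nonemptyCutSets G₁) {Set.range Sum.inr} ∧
    -- (b)
    IsLeast
      ({((2 * t : ℕ) : ℕ∞) + ∑ i, (binomialEdgeIdeal K (H i)).height} ∪
        {h | ∃ T ∈ nonemptyCutSets G₁,
          h = ((2 * (n - t) : ℕ) : ℕ∞) + (primeOf K G₁ T).height} ∪
        {((n - 1 : ℕ) : ℕ∞)})
      (binomialEdgeIdeal K (graphJoin G₁ (disjointUnion H))).height ∧
    -- (c)
    IsGreatest
      ({∑ i, ringKrullDim (PolyRing K (W i) ⧸ binomialEdgeIdeal K (H i))} ∪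
        {d | ∃ T ∈ nonemptyCutSets G₁, d = ringKrullDim (PolyRing K V ⧸ primeOf K G₁ T)} ∪
        {((n + 1 : ℕ) : WithBot ℕ∞)})
      (ringKrullDim (PolyRing K (V ⊕ Σ i, W i) ⧸
        binomialEdgeIdeal K (graphJoin G₁ (disjointUnion H)))) := by
  refine ⟨cutSets_graphJoin_disjointUnion hr G₁ H hG₁ hH, ?_⟩
  have hV := hG₁.nonempty
  have hW := fun i => (hH i).nonempty
  obtain ⟨S, hS1, hS2, hmin⟩ :=
    exists_height_binomialEdgeIdeal K (graphJoin G₁ (disjointUnion H))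
  choose A hA1 hA2 hAmin using fun i => exists_height_binomialEdgeIdeal K (H i)
  have hcardW : Fintype.card (Σ i, W i) = n - t := by
    rw [Fintype.card_sigma, hn, Nat.add_sub_cancel_left]
    exact Finset.sum_congr rfl fun i _ => hN i
  have htn : t ≤ n := by omega
  have ht1 : 1 ≤ t := ht ▸ Fintype.card_pos
  have hcard : Fintype.card (V ⊕ Σ i, W i) = n := by
    rw [Fintype.card_sum, hcardW, ht]
    omega
  have hempty : deletedComponents (graphJoin G₁ (disjointUnion H)) ∅ = 1 :=
    deletedComponents_graphJoin_eq_one _ _ (v := Classical.arbitrary V)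
      (w := ⟨⟨0, by omega⟩, Classical.arbitrary _⟩) (Set.notMem_empty _) (Set.notMem_empty _)
  have hSle := ncard_add_deletedComponents_le (graphJoin G₁ (disjointUnion H)) S
  have hAle := fun i => ncard_add_deletedComponents_le (H i) (A i)
  rw [hcard] at hS1 hS2 hSle
  simp only [hN] at hA1 hA2 hAle
  have hsum1 : ∑ i, (binomialEdgeIdeal K (H i)).height =
      ((∑ i, ((A i).ncard + (N i - deletedComponents (H i) (A i))) : ℕ) : ℕ∞) := by
    rw [Nat.cast_sum]
    exact Finset.sum_congr rfl fun i _ => hA1 i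
  have hsum2 : ∑ i, ringKrullDim (PolyRing K (W i) ⧸ binomialEdgeIdeal K (H i)) =
      ((∑ i, (N i - (A i).ncard + deletedComponents (H i) (A i)) : ℕ) : WithBot ℕ∞) := by
    rw [Nat.cast_sum]
    exact Finset.sum_congr rfl fun i _ => hA2 i
  have hheight : ∑ i, ((A i).ncard + (N i - deletedComponents (H i) (A i))) +
      ∑ i, deletedComponents (H i) (A i) = ∑ i, (A i).ncard + ∑ i, N i := by
    rw [← Finset.sum_add_distrib, ← Finset.sum_add_distrib]
    exact Finset.sum_congr rfl fun i _ => by have := hAle i; omega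
  have hdim : ∑ i, (N i - (A i).ncard + deletedComponents (H i) (A i)) + ∑ i, (A i).ncard =
      ∑ i, N i + ∑ i, deletedComponents (H i) (A i) := by
    rw [← Finset.sum_add_distrib, ← Finset.sum_add_distrib]
    exact Finset.sum_congr rfl fun i _ => by have := hAle i; omega
  -- Comparing `S` with `V` joined to the optimal sets `A i`, with the sets containing all of the `W
  -- i`, and with `∅` gives the bounds by the three kinds of terms.
  have hleft := hmin (Set.range Sum.inl ∪ Sum.inr '' {x : Σ i, W i | x.2 ∈ A x.1})
  rw [ncard_range_inl_union, deletedComponents_graphJoin_left, ncard_sigma,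
    deletedComponents_disjointUnion, ht] at hleft
  have hpre : ∀ i, Sigma.mk i ⁻¹' {x : Σ i, W i | x.2 ∈ A x.1} = A i := fun i => rfl
  simp only [hpre] at hleft
  have hright : ∀ T : Set V, _ := fun T => hmin (Sum.inl '' T ∪ Set.range Sum.inr)
  simp only [ncard_image_union_range_inr, deletedComponents_graphJoin_right, hcardW] at hright
  have hbot := hmin ∅
  rw [hempty, Set.ncard_empty] at hbot
  have hTle := fun T => ncard_add_deletedComponents_le G₁ T
  rw [ht] at hTle
  rw [hS1, hS2, hsum1, hsum2]
  simp only [height_primeOf, ringKrullDim_quotient_primeOf, ht]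
  have hScut := (mem_cutSets_join_iff hr G₁ H hG₁ hH S).1
    (mem_cutSets_iff.2 (hasCutPointProperty_of_minimal _ S hmin))
  refine ⟨⟨?_, ?_⟩, ⟨?_, ?_⟩⟩
  · rcases hScut with rfl | ⟨T, hT, rfl⟩ | ⟨T, hT, rfl⟩
    · right
      rw [Set.mem_singleton_iff, hempty, Set.ncard_empty, Nat.zero_add]
    · left; left
      rw [Set.mem_singleton_iff]
      rw [ncard_range_inl_union, deletedComponents_graphJoin_left, ncard_sigma,
        deletedComponents_disjointUnion, ht] at *
      -- Optimality of each `A i` gives the inequality opposite to `hleft`, so the trace of `S` on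
      -- the pieces is as good as the `A i`.
      have := Finset.sum_le_sum fun i (_ : i ∈ Finset.univ) => hAmin i (Sigma.mk i ⁻¹' T)
      rw [Finset.sum_add_distrib, Finset.sum_add_distrib] at this
      norm_cast
      omega
    · left; right
      refine ⟨T, hT, ?_⟩
      rw [ncard_image_union_range_inr, deletedComponents_graphJoin_right, hcardW]
      have := hTle T
      norm_cast
      omega
  · rintro _ ((rfl | ⟨T, hT, rfl⟩) | rfl)
    · norm_cast
      omega
    · have h1 := hright T
      have h2 := hTle T
      norm_cast
      omega
    · norm_cast
      omega
  · rcases hScut with rfl | ⟨T, hT, rfl⟩ | ⟨T, hT, rfl⟩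
    · right
      rw [Set.mem_singleton_iff, hempty, Set.ncard_empty, Nat.sub_zero]
    · left; left
      rw [Set.mem_singleton_iff]
      rw [ncard_range_inl_union, deletedComponents_graphJoin_left, ncard_sigma,
        deletedComponents_disjointUnion, ht] at *
      have := Finset.sum_le_sum fun i (_ : i ∈ Finset.univ) => hAmin i (Sigma.mk i ⁻¹' T)
      rw [Finset.sum_add_distrib, Finset.sum_add_distrib] at this
      norm_cast
      omega
    · left; right
      refine ⟨T, hT, ?_⟩
      rw [ncard_image_union_range_inr, deletedComponents_graphJoin_right, hcardW]
      have := hTle T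
      norm_cast
      omega
  · rintro _ ((rfl | ⟨T, hT, rfl⟩) | rfl)
    · norm_cast
      omega
    · have h1 := hright T
      have h2 := hTle T
      norm_cast
      omega
    · norm_cast
      omega
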